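/- Let $n\ge 3$. For $t=(t_{i,j,k})_{1\le i<j<k\le n}$ with integer entries let $$G(t)=\langle a_1,\dots,a_n \mid a_ja_i=a_ia_j\,a_{j+1}^{t_{i,j,j+1}}\cdots a_n^{t_{i,j,n}}\ (1\le i<j\le n)\rangle,$$ and let $\mathcal C_n$ be the set of all $t\in\mathbb Z^{\binom n3}$ for which $G(t)$ has Hirsch length exactly $n$. Let $T=(T_{i,j,k})_{1\le i<j<k\le n}$ be indeterminates, and put $T_u=(T_{i,j,k}\mid i,j,k\ne 1)$ and $t_u=(t_{i,j,k}\mid i,j,k\neq 1)$, re-indexed by $i\mapsto i-1$ as parameters for $n-1$ generators. Rational polynomials $R_{i,j,k}(T;u,v)$ ($1\le i<j<k\le n$) are called *conjugation polynomials* if for all $t\in\mathcal C_n$ and $u,v\in\mathbb Z$ the values $R_{i,j,k}(t;u,v)$ are integers and, for all $i<j$, $$a_j^ua_i^v=a_i^va_j^u\,a_{j+1}^{R_{i,j,j+1}(t;u,v)}\cdots a_n^{R_{i,j,n}(t;u,v)}\quad\text{in } G(t).$$ Rational polynomials $K_1,\dots,K_{n-1}$ in parameters for $n-1$ generators and indeterminates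 $x=(x_1,\dots,x_{n-1})$ and $z$ are called *powering polynomials* for $n-1$ generators if for all $s\in\mathcal C_{n-1}$, $x\in\mathbb Z^{n-1}$ and $z\in\mathbb Z$ the values $K_i(s;x,z)$ are integers and, with $a_1,\dots,a_{n-1}$ denoting the generators of $G(s)$, $(a_1^{x_1}\cdots a_{n-1}^{x_{n-1}})^z=a_1^{K_1(s;x,z)}\cdots a_{n-1}^{K_{n-1}(s;x,z)}$ in $G(s)$. Then the following hold. 1. Let $K_1,\dots,K_{n-1}$ be powering polynomials for $n-1$ generators, let $R_{i,j,k}$ be conjugation polynomials for $n$ generators, and put $r=(1,R_{1,2,3}(T;1,v),\dots,R_{1,2,n}(T;1,v))$. Then $$R_{1,2,n}(T;u,v)=K_{n-1}(T_u;r,u)$$ in the sense that for each $t\in\mathcal C_n$ the two sides become equal as polynomials in $\mathbb Q[u,v]$ when $T$ is replaced by $t$. 2. (Reduction to $u=1$.) Let $K_1,\dots,K_{n-1}$ be powering polynomials for $n-1$ generators and let $\rho_3,\dots,\rho_n\in\mathbb Q[T,v]$ be such that for all $t\in\mathcal C_n$ and $v\in\mathbb Z$ the values $\rho_k(t;v)$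 are integers and $a_2a_1^v=a_1^va_2\,a_3^{\rho_3(t;v)}\cdots a_n^{\rho_n(t;v)}$ in $G(t)$. Put $P_k(T;u,v)=K_{k-1}(T_u;(1,\rho_3,\dots,\rho_n),u)$ for $3\le k\le n$. Then for all $t\in\mathcal C_n$ and $u,v\in\mathbb Z$ the values $P_k(t;u,v)$ are integers and $a_2^ua_1^v=a_1^va_2^u\,a_3^{P_3(t;u,v)}\cdots a_n^{P_n(t;u,v)}$ in $G(t)$. 3. For each $t\in\mathcal C_n$ we have $t_u\in\mathcal C_{n-1}$, and mapping the $i$-th generator of $G(t_u)$ to $a_{i+1}$ for $1\le i\le n-1$ defines an isomorphism from $G(t_u)$ onto the subgroup $U(t)=\langle a_2,\dots,a_n\rangle$ of $G(t)$. -/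

import Mathlib

namespace HallPoly

open MvPolynomial

/-- The index set of the parameters `T_{i,j,k}`: triples `i < j < k` in `Fin n`
(the generators `a_1, …, a_n` are numbered from `0`). -/
abbrev Triple (n : ℕ) : Type :=
  {p : Fin n × Fin n × Fin n // p.1 < p.2.1 ∧ p.2.1 < p.2.2}

/-- The ordered product `a_1 ^ x_1 * ⋯ * a_n ^ x_n`. -/
def orderedProd {G : Type*} [Group G] {n : ℕ} (a : Fin n → G) (x : Fin n → ℤ) : G :=
  (List.ofFn fun i => a i ^ x i).prod

/-- The exponent vector `(0, …, 0, c_{i,j,j+1}, …, c_{i,j,n})` of the tail of the pair `i < j`. -/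
def tailExp {n : ℕ} (c : Triple n → ℤ) (i j : Fin n) (hij : i < j) : Fin n → ℤ :=
  fun k => if hjk : j < k then c ⟨(i, j, k), hij, hjk⟩ else 0

/-- The relators of the presentation with relations
`a_j a_i = a_i a_j a_{j+1}^{t_{i,j,j+1}} ⋯ a_n^{t_{i,j,n}}` for `i < j`. -/
def relators {n : ℕ} (t : Triple n → ℤ) : Set (FreeGroup (Fin n)) :=
  {w | ∃ (i j : Fin n) (hij : i < j),
    w = (FreeGroup.of j * FreeGroup.of i) *
      (FreeGroup.of i * FreeGroup.of j * orderedProd FreeGroup.of (tailExp t i j hij))⁻¹}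

/-- The group `G(t)`. -/
abbrev NilpGroup {n : ℕ} (t : Triple n → ℤ) : Type :=
  PresentedGroup (relators t)

/-- The generators `a_1, …, a_n` of `G(t)`. -/
def gen {n : ℕ} (t : Triple n → ℤ) (i : Fin n) : NilpGroup t :=
  PresentedGroup.of i

/-- `G` is polycyclic of Hirsch length `h`: there is a subnormal series
`G = H 0 ≥ H 1 ≥ ⋯ ≥ H m = 1` with cyclic factors, exactly `h` of which are infinite. -/
def HasHirschLength (G : Type*) [Group G] (h : ℕ) : Prop :=
  ∃ (m : ℕ) (H : ℕ → Subgroup G), H 0 = ⊤ ∧ H m = ⊥ ∧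
    (∀ i < m, H (i + 1) ≤ H i ∧
      ∃ _ : ((H (i + 1)).subgroupOf (H i)).Normal,
        IsCyclic (H i ⧸ (H (i + 1)).subgroupOf (H i))) ∧
    {i : ℕ | i < m ∧ Infinite (H i ⧸ (H (i + 1)).subgroupOf (H i))}.ncard = h

/-- The set `𝒞_n` of the parameters `t` for which `G(t)` is consistent. -/
def consistentSet (n : ℕ) : Set (Triple n → ℤ) :=
  {t | HasHirschLength (NilpGroup t) n}

/-- Rational polynomials in the parameters `T_{i,j,k}` and further indeterminates `σ`. -/
abbrev ParamPoly (n : ℕ) (σ : Type) : Type :=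
  MvPolynomial (Triple n ⊕ σ) ℚ

/-- The indeterminates `u, v`. -/
inductive ConjVar : Type
  | u
  | v

/-- The single indeterminate `v`. -/
inductive UnitVar : Type
  | v

/-- The indeterminates `x_1, …, x_n, z`. -/
inductive PowVar (n : ℕ) : Type
  | x (i : Fin n)
  | z

/-- The polynomial `P(t; σ)` in `ℚ[σ]`, obtained by replacing `T` by `t`. -/
noncomputable def specialize {n : ℕ} {σ : Type} (t : Triple n → ℤ) :
    ParamPoly n σ →ₐ[ℚ] MvPolynomial σ ℚ :=
  aeval (Sum.elim (fun p => C (t p : ℚ)) X)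

/-- The value `P(t; s)` at integers `t` and `s`. -/
noncomputable def value {n : ℕ} {σ : Type} (t : Triple n → ℤ) (s : σ → ℤ)
    (P : ParamPoly n σ) : ℚ :=
  eval (fun w => ((Sum.elim t s w : ℤ) : ℚ)) P

/-- Assignment of values to `u, v`. -/
def conjVals (u v : ℤ) : ConjVar → ℤ
  | .u => u
  | .v => v

/-- Assignment of values to `x_1, …, x_n, z`. -/
def powVals {n : ℕ} (x : Fin n → ℤ) (z : ℤ) : PowVar n → ℤ
  | .x i => x i
  | .z => z

/-- `K_1, …, K_n` are powering polynomials: for all `t ∈ 𝒞_n`, `x ∈ ℤ^n` and `z ∈ ℤ` the values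
`K_i(t; x, z)` are integers and
`(a_1^{x_1} ⋯ a_n^{x_n})^z = a_1^{K_1(t; x, z)} ⋯ a_n^{K_n(t; x, z)}` in `G(t)`. -/
def IsPowering {n : ℕ} (K : Fin n → ParamPoly n (PowVar n)) : Prop :=
  ∀ t ∈ consistentSet n, ∀ (x : Fin n → ℤ) (z : ℤ), ∃ e : Fin n → ℤ,
    (∀ i, value t (powVals x z) (K i) = (e i : ℚ)) ∧
    orderedProd (gen t) x ^ z = orderedProd (gen t) e

/-- The polynomials `R_{i,j,k}` are conjugation polynomials: for all `t ∈ 𝒞_n` and `u, v ∈ ℤ`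
the values `R_{i,j,k}(t; u, v)` are integers and, for all `i < j`,
`a_j^u a_i^v = a_i^v a_j^u a_{j+1}^{R_{i,j,j+1}(t; u, v)} ⋯ a_n^{R_{i,j,n}(t; u, v)}`
in `G(t)`. -/
def IsConjugation {n : ℕ} (R : Triple n → ParamPoly n ConjVar) : Prop :=
  ∀ t ∈ consistentSet n, ∀ u v : ℤ, ∃ e : Triple n → ℤ,
    (∀ p, value t (conjVals u v) (R p) = (e p : ℚ)) ∧
    ∀ (i j : Fin n) (hij : i < j),
      gen t j ^ u * gen t i ^ v =
        gen t i ^ v * gen t j ^ u * orderedProd (gen t) (tailExp e i j hij)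

/-- The exponent vector `(0, 0, e_3, …, e_n)`, where `n = m + 3`. -/
def fromThird {m : ℕ} (e : Fin (m + 1) → ℤ) : Fin (m + 3) → ℤ :=
  Fin.cons 0 (Fin.cons 0 e)

/-- The polynomials `P_3, …, P_n` in `T, u, v` satisfy the defining property of
`R_{1,2,3}, …, R_{1,2,n}`, where `n = m + 3`: for all `t ∈ 𝒞_n` and `u, v ∈ ℤ` the values are
integers and `a_2^u a_1^v = a_1^v a_2^u a_3^{P_3(t; u, v)} ⋯ a_n^{P_n(t; u, v)}` in `G(t)`. -/
def IsConjugationOneTwo {m : ℕ} (P : Fin (m + 1) → ParamPoly (m + 3) ConjVar) : Prop :=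
  ∀ t ∈ consistentSet (m + 3), ∀ u v : ℤ, ∃ e : Fin (m + 1) → ℤ,
    (∀ k, value t (conjVals u v) (P k) = (e k : ℚ)) ∧
    gen t 1 ^ u * gen t 0 ^ v =
      gen t 0 ^ v * gen t 1 ^ u * orderedProd (gen t) (fromThird e)

/-- The polynomials `ρ_3, …, ρ_n` in `T, v` satisfy the defining property of
`R_{1,2,3}(T; 1, v), …, R_{1,2,n}(T; 1, v)`, where `n = m + 3`: for all `t ∈ 𝒞_n` and `v ∈ ℤ`
the values are integers and `a_2 a_1^v = a_1^v a_2 a_3^{ρ_3(t; v)} ⋯ a_n^{ρ_n(t; v)}`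
in `G(t)`. -/
def IsUnitConjugationOneTwo {m : ℕ} (ρ : Fin (m + 1) → ParamPoly (m + 3) UnitVar) : Prop :=
  ∀ t ∈ consistentSet (m + 3), ∀ v : ℤ, ∃ e : Fin (m + 1) → ℤ,
    (∀ k, value t (fun _ => v) (ρ k) = (e k : ℚ)) ∧
    gen t 1 * gen t 0 ^ v =
      gen t 0 ^ v * gen t 1 * orderedProd (gen t) (fromThird e)

/-- The triple `(1, 2, k)` for `3 ≤ k ≤ n`, where `n = m + 3`. -/
def tripleOneTwo {m : ℕ} (k : Fin (m + 1)) : Triple (m + 3) :=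
  ⟨(0, 1, k.succ.succ), Fin.succ_pos 0, Fin.succ_lt_succ_iff.2 (Fin.succ_pos k)⟩

/-- The triple `(i + 1, j + 1, k + 1)`. -/
def Triple.shift {n : ℕ} (p : Triple n) : Triple (n + 1) :=
  ⟨(p.1.1.succ, p.1.2.1.succ, p.1.2.2.succ),
    Fin.succ_lt_succ_iff.2 p.2.1, Fin.succ_lt_succ_iff.2 p.2.2⟩

/-- The parameters `t_u = (t_{i,j,k} | i, j, k ≠ 1)`. -/
def dropFirst {n : ℕ} (t : Triple (n + 1) → ℤ) : Triple n → ℤ :=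
  fun p => t p.shift

/-- The subgroup `U(t) = ⟨a_2, …, a_n⟩` of `G(t)`. -/
def subgroupU {n : ℕ} (t : Triple (n + 1) → ℤ) : Subgroup (NilpGroup t) :=
  Subgroup.closure (Set.range fun i : Fin n => gen t i.succ)

/-- The polynomial `P(T; 1, v)`. -/
noncomputable def atOne {n : ℕ} (P : ParamPoly n ConjVar) : ParamPoly n UnitVar :=
  aeval (Sum.elim (fun p => X (Sum.inl p))
    (fun | ConjVar.u => 1 | ConjVar.v => X (Sum.inr UnitVar.v))) P

/-- The polynomial `K(T_u; (1, ρ_3, …, ρ_n), u)` in `ℚ[T, u, v]`, where `n = m + 3`, `K` is a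
polynomial for `n - 1` generators and the `ρ_k` are polynomials in `T, v`. -/
noncomputable def powerSubst {m : ℕ} (K : ParamPoly (m + 2) (PowVar (m + 2)))
    (ρ : Fin (m + 1) → ParamPoly (m + 3) UnitVar) : ParamPoly (m + 3) ConjVar :=
  let r : Fin (m + 2) → ParamPoly (m + 3) UnitVar := Fin.cons 1 ρ
  aeval (Sum.elim (fun p => X (Sum.inl p.shift))
    (fun
      | PowVar.x i => rename (Sum.map id fun _ => ConjVar.v) (r i)
      | PowVar.z => X (Sum.inr ConjVar.u))) K

end HallPoly

/-! The engine is uniqueness of normal forms. The subgroups generated by `a_k, …, a_n` are normal in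
`G(t)` with cyclic successive factors, so every element is an ordered product. A comparison of
series shows that Hirsch length `n` forces all `n` of these factors to be infinite, that is, no
nontrivial power of `a_i` lies in the next tail (`Independent`). This makes exponent vectors unique
(`Independent.orderedProd_injective`); conversely, independence of the generators gives Hirsch
length `n`.

Independence can be pulled back along homomorphisms, so the natural map `G(t_u) → G(t)` shows that
`t_u` is consistent, and it is injective because it sends normal forms to normal forms in
independent elements.

For the reduction to `u = 1`, conjugating `a_2` by `a_1^v` gives `a_2 a_3^{ρ_3} ⋯ a_n^{ρ_n}`, an
element of the image of `G(t_u)`. Its `u`-th power is therefore computed by powering there. The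
formula for `R_{1,2,n}` follows: both sides have equal values at all integers `u, v` by uniqueness
of normal forms, hence are equal polynomials. -/

namespace HallPoly

/-! ### Infinite factors of subnormal series -/

section Rank

universe v

variable {G : Type v} [Group G]

theorem relIndex_ne_zero_of_cover {ι : Type*} [Finite ι] {L P : Subgroup G} (f : ι → G)
    (h : ∀ p ∈ P, ∃ i, (f i)⁻¹ * p ∈ L) : L.relIndex P ≠ 0 := by
  have h' : ∀ q : P ⧸ L.subgroupOf P, ∃ i, (f i)⁻¹ * (q.out : G) ∈ L := fun q => h _ q.out.2
  choose g hg using h'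
  have hinj : Function.Injective g := by
    intro q q' hqq
    have h1 := hg q'
    rw [← hqq] at h1
    have h2 := L.mul_mem (L.inv_mem (hg q)) h1
    rw [← q.out_eq', ← q'.out_eq']
    refine QuotientGroup.eq.2 (Subgroup.mem_subgroupOf.2 ?_)
    push_cast
    convert h2 using 1
    group
  have := Finite.of_injective g hinj
  have : (L.subgroupOf P).FiniteIndex := Subgroup.finiteIndex_of_finite_quotient
  exact this.index_ne_zero

theorem exists_cover_of_relIndex_ne_zero {L P : Subgroup G} (h : L.relIndex P ≠ 0) :
    ∃ (ι : Type v) (_ : Finite ι) (f : ι → G), ∀ p ∈ P, ∃ i, (f i)⁻¹ * p ∈ L := by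
  have : (L.subgroupOf P).FiniteIndex := ⟨h⟩
  refine ⟨P ⧸ L.subgroupOf P, inferInstance, fun q => (q.out : G), fun p hp =>
    ⟨QuotientGroup.mk ⟨p, hp⟩, ?_⟩⟩
  have h1 := QuotientGroup.eq.1
    (Quotient.out_eq' (QuotientGroup.mk ⟨p, hp⟩ : P ⧸ L.subgroupOf P))
  exact Subgroup.mem_subgroupOf.1 h1

theorem infinite_quotient_iff_relIndex_eq_zero {L P : Subgroup G} :
    Infinite (P ⧸ L.subgroupOf P) ↔ L.relIndex P = 0 := by
  change _ ↔ Nat.card (P ⧸ L.subgroupOf P) = 0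
  rw [Nat.card_eq_zero]
  exact ⟨Or.inr, fun h => h.resolve_left (fun h => h.elim (1 : P))⟩

/-- One step up a series with cyclic factors: if `A ⊓ K` has infinite image in `A / B`, so does `A ⊓
L`, and a nontrivial subgroup of a cyclic group with infinite subgroups has finite index. Otherwise
`B ⊓ K` already has finite index in `A ⊓ K`. -/
theorem relIndex_inf_ne_zero_of_cyclic_factor {A B K L : Subgroup G} [B.Normal] {a : G}
    (hcyc : ∀ g ∈ A, ∃ z : ℤ, (g : G ⧸ B) = (a : G ⧸ B) ^ z) (hLK : L ≤ K)
    (hB : L.relIndex (B ⊓ K) ≠ 0)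
    (hinf : B.relIndex (A ⊓ K) = 0 → B.relIndex (A ⊓ L) = 0) :
    L.relIndex (A ⊓ K) ≠ 0 := by
  by_cases hK : B.relIndex (A ⊓ K) = 0
  · have hL := hinf hK
    obtain ⟨g, ⟨hgA, hgL⟩, hgB⟩ : ∃ g, (g ∈ A ∧ g ∈ L) ∧ g ∉ B := by
      by_contra! hcon
      have : B.relIndex (A ⊓ L) = 1 := Subgroup.relIndex_eq_one.2 fun g hg => hcon g hg
      omega
    obtain ⟨z, hz⟩ := hcyc g hgA
    have hz0 : z ≠ 0 := by
      rintro rfl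
      rw [zpow_zero] at hz
      exact hgB ((QuotientGroup.eq_one_iff g).1 hz)
    obtain ⟨ι, _, f, hf⟩ := exists_cover_of_relIndex_ne_zero hB
    have : NeZero z.natAbs := ⟨by simpa using hz0⟩
    -- Elements of `A ⊓ K` are sorted by their exponent modulo `z`, where `g ≡ a ^ z`. With one
    -- representative `c r` per residue that occurs, each `p` is `c r * n * g ^ q` with `n ∈ B ⊓ K`,
    -- so the `c r * f i` cover all cosets of `L`.
    let Q : ZMod z.natAbs → G → Prop := fun r p =>
      p ∈ A ⊓ K ∧ ∃ w : ℤ, (w : ZMod z.natAbs) = r ∧ (p : G ⧸ B) = (a : G ⧸ B) ^ w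
    have hQ : ∀ r, ∃ p, (∃ p', Q r p') → Q r p := by
      intro r
      by_cases h : ∃ p', Q r p'
      · exact ⟨h.choose, fun _ => h.choose_spec⟩
      · exact ⟨1, fun h' => (h h').elim⟩
    choose c hc using hQ
    refine relIndex_ne_zero_of_cover (ι := ZMod z.natAbs × ι) (fun i => c i.1 * f i.2) ?_
    intro p hp
    obtain ⟨w, hw⟩ := hcyc p hp.1
    obtain ⟨hcP, w', hw', hcw⟩ := hc (w : ZMod z.natAbs) ⟨p, hp, w, rfl, hw⟩
    obtain ⟨q, hq⟩ : z ∣ w - w' := by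
      rw [← Int.natAbs_dvd]
      exact (ZMod.intCast_eq_intCast_iff_dvd_sub _ _ _).1 hw'
    have hn : (c (w : ZMod z.natAbs))⁻¹ * p * g ^ (-q) ∈ B ⊓ K := by
      refine ⟨(QuotientGroup.eq_one_iff _).1 ?_,
        K.mul_mem (K.mul_mem (K.inv_mem hcP.2) hp.2) (K.zpow_mem (hLK hgL) _)⟩
      rw [QuotientGroup.mk_mul, QuotientGroup.mk_mul, QuotientGroup.mk_inv, QuotientGroup.mk_zpow]
      rw [hcw, hw, hz, ← zpow_neg, ← zpow_add, ← zpow_mul, ← zpow_add]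
      rw [show -w' + w + z * -q = 0 by linarith, zpow_zero]
    obtain ⟨i, hi⟩ := hf _ hn
    refine ⟨((w : ZMod z.natAbs), i), ?_⟩
    have h3 := L.mul_mem hi (L.zpow_mem hgL q)
    convert h3 using 1
    simp only [zpow_neg]
    group
  · refine Subgroup.relIndex_ne_zero_trans hB (Subgroup.relIndex_inf_ne_zero hK ?_)
    rw [Subgroup.relIndex_eq_one.2 inf_le_right]
    exact one_ne_zero

/-- The number of infinite factors of the series induced on `K` by `A 0 ≥ ⋯ ≥ A n`. -/
noncomputable def infiniteFactorCount (A : ℕ → Subgroup G) (n : ℕ) (K : Subgroup G) : ℕ :=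
  {i | i < n ∧ (A (i + 1)).relIndex (A i ⊓ K) = 0}.ncard

theorem finite_setOf_lt_and (n : ℕ) (p : ℕ → Prop) : {i | i < n ∧ p i}.Finite :=
  (Set.finite_lt_nat n).subset fun _ h => h.1

theorem infiniteFactors_subset (A : ℕ → Subgroup G) (n : ℕ) {K L : Subgroup G} (h : L ≤ K) :
    {i | i < n ∧ (A (i + 1)).relIndex (A i ⊓ L) = 0} ⊆
      {i | i < n ∧ (A (i + 1)).relIndex (A i ⊓ K) = 0} := fun _ hi =>
  ⟨hi.1, Subgroup.relIndex_eq_zero_of_le_right (inf_le_inf_left _ h) hi.2⟩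

theorem infiniteFactorCount_mono (A : ℕ → Subgroup G) (n : ℕ) {K L : Subgroup G} (h : L ≤ K) :
    infiniteFactorCount A n L ≤ infiniteFactorCount A n K :=
  Set.ncard_le_ncard (infiniteFactors_subset A n h) (finite_setOf_lt_and _ _)

/-- If the counts agreed, the same factors would be infinite on `L` and on `K`; climbing from `A n =
⊥` to `A 0 = ⊤` would then give `L` finite index in `K`. -/
theorem infiniteFactorCount_lt {A : ℕ → Subgroup G} {n : ℕ} {a : ℕ → G}
    (hnormal : ∀ i, (A i).Normal) (htop : A 0 = ⊤) (hbot : A n = ⊥)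
    (hcyc : ∀ i < n, ∀ g ∈ A i, ∃ z : ℤ, (g : G ⧸ A (i + 1)) = (a i : G ⧸ A (i + 1)) ^ z)
    {K L : Subgroup G} (hLK : L ≤ K) (hidx : L.relIndex K = 0) :
    infiniteFactorCount A n L < infiniteFactorCount A n K := by
  refine Set.ncard_lt_ncard ⟨infiniteFactors_subset A n hLK, fun hsub => ?_⟩
    (finite_setOf_lt_and _ _)
  have key : ∀ j ≤ n, L.relIndex (A (n - j) ⊓ K) ≠ 0 := by
    intro j
    induction j with
    | zero => intro _; simp [hbot]
    | succ j ih =>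
      intro hj
      have h := ih (by omega)
      obtain ⟨i, hi, hi', hin⟩ : ∃ i, n - (j + 1) = i ∧ n - j = i + 1 ∧ i < n :=
        ⟨n - (j + 1), rfl, by omega, by omega⟩
      rw [hi'] at h
      rw [hi]
      exact relIndex_inf_ne_zero_of_cyclic_factor (hcyc i hin) hLK h fun h0 => (hsub ⟨hin, h0⟩).2
  have h := key n le_rfl
  rw [Nat.sub_self, htop, top_inf_eq] at h
  exact h hidx

/-- A subnormal series has at most as many infinite factors as a series with cyclic factors. -/
theorem ncard_infinite_le_infiniteFactorCount {A : ℕ → Subgroup G} {n : ℕ} {a : ℕ → G}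
    (hnormal : ∀ i, (A i).Normal) (htop : A 0 = ⊤) (hbot : A n = ⊥)
    (hcyc : ∀ i < n, ∀ g ∈ A i, ∃ z : ℤ, (g : G ⧸ A (i + 1)) = (a i : G ⧸ A (i + 1)) ^ z)
    (H : ℕ → Subgroup G) (m : ℕ) (hH : ∀ i < m, H (i + 1) ≤ H i) :
    {i | i < m ∧ (H (i + 1)).relIndex (H i) = 0}.ncard + infiniteFactorCount A n (H m) ≤
      infiniteFactorCount A n (H 0) := by
  induction m with
  | zero => simp
  | succ m ih =>
    have h := ih fun i hi => hH i (by omega)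
    by_cases h0 : (H (m + 1)).relIndex (H m) = 0
    -- Each infinite factor of `H` costs at least one infinite factor of the series induced by `A`.
    · have hlt := infiniteFactorCount_lt hnormal htop hbot hcyc (hH m (by omega)) h0
      have hsub : {i | i < m + 1 ∧ (H (i + 1)).relIndex (H i) = 0} ⊆
          insert m {i | i < m ∧ (H (i + 1)).relIndex (H i) = 0} := by
        rintro i ⟨hi, hi'⟩
        rcases Nat.lt_succ_iff_lt_or_eq.1 hi with h | h
        · exact Or.inr ⟨h, hi'⟩
        · exact Or.inl h
      have h1 := Set.ncard_le_ncard hsub ((finite_setOf_lt_and _ _).insert m)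
      have h2 := Set.ncard_insert_le m {i | i < m ∧ (H (i + 1)).relIndex (H i) = 0}
      omega
    · have hle := infiniteFactorCount_mono A n (hH m (by omega))
      have hsub : {i | i < m + 1 ∧ (H (i + 1)).relIndex (H i) = 0} ⊆
          {i | i < m ∧ (H (i + 1)).relIndex (H i) = 0} := by
        rintro i ⟨hi, hi'⟩
        rcases Nat.lt_succ_iff_lt_or_eq.1 hi with h | h
        · exact ⟨h, hi'⟩
        · exact absurd (h ▸ hi') h0
      have h1 := Set.ncard_le_ncard hsub (finite_setOf_lt_and _ _)
      omega

/-- The `n` infinite factors of the given series are at most as many as those of `A`, which has only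
`n` factors in total. -/
theorem relIndex_eq_zero_of_hasHirschLength {A : ℕ → Subgroup G} {n : ℕ} {a : ℕ → G}
    (hnormal : ∀ i, (A i).Normal) (htop : A 0 = ⊤) (hbot : A n = ⊥)
    (hcyc : ∀ i < n, ∀ g ∈ A i, ∃ z : ℤ, (g : G ⧸ A (i + 1)) = (a i : G ⧸ A (i + 1)) ^ z)
    (h : HasHirschLength G n) {i : ℕ} (hi : i < n) : (A (i + 1)).relIndex (A i) = 0 := by
  obtain ⟨m, H, h0, -, hs, hcard⟩ := h
  have hset : {i | i < m ∧ Infinite (H i ⧸ (H (i + 1)).subgroupOf (H i))} =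
      {i | i < m ∧ (H (i + 1)).relIndex (H i) = 0} :=
    Set.ext fun _ => and_congr_right fun _ => infinite_quotient_iff_relIndex_eq_zero
  rw [hset] at hcard
  have h1 := ncard_infinite_le_infiniteFactorCount hnormal htop hbot hcyc H m fun i hi => (hs i hi).1
  have h2 : infiniteFactorCount A n ⊤ = {i | i < n ∧ (A (i + 1)).relIndex (A i) = 0}.ncard := by
    simp [infiniteFactorCount]
  rw [hcard, h0, h2] at h1
  have hfin : (Set.Iio n).Finite := Set.finite_Iio n
  have hsub : {i | i < n ∧ (A (i + 1)).relIndex (A i) = 0} ⊆ Set.Iio n := fun _ h => h.1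
  have hc : (Set.Iio n).ncard = n := by
    rw [Set.ncard_eq_toFinset_card']; simp
  have heq := Set.eq_of_subset_of_ncard_le hsub (by omega) hfin
  have : i ∈ Set.Iio n := hi
  rw [← heq] at this
  exact this.2

end Rank

/-! ### The tail series, independence and normal forms -/

section Series

variable {G : Type*} [Group G] {n : ℕ}

/-- The elements `a_1, …, a_n` satisfy the relations of `G(t)`. -/
def Satisfies (t : Triple n → ℤ) (a : Fin n → G) : Prop :=
  ∀ (i j : Fin n) (hij : i < j),
    a j * a i = a i * a j * orderedProd a (tailExp t i j hij)

/-- The subgroup generated by the `a_j` with `k ≤ j`. -/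
def tailSubgroup (a : Fin n → G) (k : ℕ) : Subgroup G :=
  Subgroup.closure (a '' {j | k ≤ (j : ℕ)})

theorem mem_tailSubgroup (a : Fin n → G) {k : ℕ} {j : Fin n} (h : k ≤ j) :
    a j ∈ tailSubgroup a k :=
  Subgroup.subset_closure ⟨j, h, rfl⟩

theorem tailSubgroup_anti (a : Fin n → G) {k l : ℕ} (h : k ≤ l) :
    tailSubgroup a l ≤ tailSubgroup a k :=
  Subgroup.closure_mono (Set.image_mono fun _ hj => h.trans hj)

theorem tailSubgroup_of_le (a : Fin n → G) {k : ℕ} (h : n ≤ k) : tailSubgroup a k = ⊥ := by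
  have : {j : Fin n | k ≤ (j : ℕ)} = ∅ := by
    ext j
    simp only [Set.mem_ofPred_eq, Set.mem_empty_iff_false, iff_false, not_le]
    exact j.2.trans_le h
  rw [tailSubgroup, this, Set.image_empty, Subgroup.closure_empty]

theorem tailSubgroup_zero (a : Fin n → G) :
    tailSubgroup a 0 = Subgroup.closure (Set.range a) := by
  simp [tailSubgroup]

theorem tailSubgroup_succ (a : Fin (n + 1) → G) (k : ℕ) :
    tailSubgroup (fun i => a i.succ) k = tailSubgroup a (k + 1) := by
  unfold tailSubgroup
  congr 1
  ext g
  constructor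
  · rintro ⟨j, hj, rfl⟩
    exact ⟨j.succ, by simpa using hj, rfl⟩
  · rintro ⟨j, hj, rfl⟩
    obtain ⟨i, rfl⟩ := Fin.exists_succ_eq.2 (show j ≠ 0 by rintro rfl; simp at hj)
    exact ⟨i, by simpa using hj, rfl⟩

theorem tailSubgroup_map {G' : Type*} [Group G'] (f : G →* G') (a : Fin n → G) (k : ℕ) :
    (tailSubgroup a k).map f = tailSubgroup (fun i => f (a i)) k := by
  rw [tailSubgroup, tailSubgroup, MonoidHom.map_closure, Set.image_image]

theorem orderedProd_mem {a : Fin n → G} {x : Fin n → ℤ} {H : Subgroup G}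
    (h : ∀ i, a i ^ x i ∈ H) : orderedProd a x ∈ H := by
  refine Subgroup.list_prod_mem _ fun g hg => ?_
  obtain ⟨i, rfl⟩ := (List.mem_ofFn' _ _).1 hg
  exact h i

theorem map_orderedProd {G' : Type*} [Group G'] (f : G →* G') (a : Fin n → G) (x : Fin n → ℤ) :
    f (orderedProd a x) = orderedProd (fun i => f (a i)) x := by
  simp [orderedProd, map_list_prod, List.map_ofFn, Function.comp_def]

theorem orderedProd_succ (a : Fin (n + 1) → G) (x : Fin (n + 1) → ℤ) :
    orderedProd a x = a 0 ^ x 0 * orderedProd (fun i => a i.succ) (fun i => x i.succ) := by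
  simp [orderedProd, List.ofFn_succ]

theorem orderedProd_succ_mem (a : Fin (n + 1) → G) (x : Fin n → ℤ) :
    orderedProd (fun i => a i.succ) x ∈ tailSubgroup a 1 :=
  orderedProd_mem fun _ => Subgroup.zpow_mem _ (mem_tailSubgroup a (by simp)) _

theorem orderedProd_tailExp_mem (a : Fin n → G) (t : Triple n → ℤ) (i j : Fin n) (hij : i < j) :
    orderedProd a (tailExp t i j hij) ∈ tailSubgroup a (j + 1) := by
  refine orderedProd_mem fun k => ?_
  by_cases h : j < k
  · exact Subgroup.zpow_mem _ (mem_tailSubgroup a (Nat.succ_le_of_lt h)) _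
  · simp [tailExp, h]

theorem Satisfies.map {G' : Type*} [Group G'] (f : G →* G') {t : Triple n → ℤ} {a : Fin n → G}
    (h : Satisfies t a) : Satisfies t (fun i => f (a i)) := fun i j hij => by
  rw [← map_orderedProd, ← map_mul, h i j hij, map_mul, map_mul]

theorem Satisfies.succ {t : Triple (n + 1) → ℤ} {a : Fin (n + 1) → G} (h : Satisfies t a) :
    Satisfies (dropFirst t) (fun i => a i.succ) := fun i j hij => by
  have h1 := h i.succ j.succ (Fin.succ_lt_succ_iff.2 hij)
  rw [orderedProd_succ] at h1
  simp only [h1, tailExp, Fin.not_lt_zero, dite_false, zpow_zero, one_mul, Fin.succ_lt_succ_iff]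
  rfl

/-- Downward induction on `k`. Only conjugating `a_k` by an earlier `a_i` is not immediate, and
there the relation changes `a_k` by an element of the next tail, already known to be normal. -/
theorem Satisfies.normal {t : Triple n → ℤ} {a : Fin n → G} (h : Satisfies t a)
    (hgen : Subgroup.closure (Set.range a) = ⊤) (k : ℕ) : (tailSubgroup a k).Normal := by
  suffices H : ∀ d k, n ≤ k + d → (tailSubgroup a k).Normal from H n k (by omega)
  intro d
  induction d with
  | zero =>
    intro k hk
    rw [tailSubgroup_of_le a (show n ≤ k from hk)]
    infer_instance
  | succ d ih =>
    intro k hk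
    have hN := ih (k + 1) (by omega)
    have hle : tailSubgroup a (k + 1) ≤ tailSubgroup a k := tailSubgroup_anti a (Nat.le_succ k)
    have hconj : ∀ i j : Fin n, k ≤ j →
        a i * a j * (a i)⁻¹ ∈ tailSubgroup a k ∧ (a i)⁻¹ * a j * a i ∈ tailSubgroup a k := by
      intro i j hj
      have hjk := mem_tailSubgroup a hj
      rcases hj.lt_or_eq with hj' | hj'
      · have hjN : a j ∈ tailSubgroup a (k + 1) := mem_tailSubgroup a hj'
        refine ⟨hle (hN.conj_mem _ hjN _), hle ?_⟩
        simpa using hN.conj_mem _ hjN (a i)⁻¹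
      · rcases le_or_gt k (i : ℕ) with hi | hi
        · have hik := mem_tailSubgroup a hi
          exact ⟨mul_mem (mul_mem hik hjk) (inv_mem hik), mul_mem (mul_mem (inv_mem hik) hjk) hik⟩
        · have hij : i < j := by rw [Fin.lt_def]; omega
          have hw := orderedProd_tailExp_mem a t i j hij
          have hr := h i j hij
          rw [← hj'] at hw
          generalize orderedProd a (tailExp t i j hij) = w at hw hr
          constructor
          · have h1 : a i * a j * (a i)⁻¹ = a j * (a i * w⁻¹ * (a i)⁻¹) := by
              rw [← mul_assoc, ← mul_assoc, hr]
              group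
            rw [h1]
            exact mul_mem hjk (hle (hN.conj_mem _ (inv_mem hw) _))
          · have h1 : (a i)⁻¹ * a j * a i = a j * w := by
              rw [mul_assoc, hr]
              group
            rw [h1]
            exact mul_mem hjk (hle hw)
    rw [← Subgroup.normalizer_eq_top_iff, eq_top_iff, ← hgen, Subgroup.closure_le]
    rintro _ ⟨i, rfl⟩
    have h1 : tailSubgroup a k ≤ (tailSubgroup a k).comap (MulAut.conj (a i)).toMonoidHom := by
      refine (Subgroup.closure_le _).2 ?_
      rintro _ ⟨j, hj, rfl⟩
      exact (hconj i j hj).1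
    have h2 : tailSubgroup a k ≤ (tailSubgroup a k).comap (MulAut.conj (a i)⁻¹).toMonoidHom := by
      refine (Subgroup.closure_le _).2 ?_
      rintro _ ⟨j, hj, rfl⟩
      simpa using (hconj i j hj).2
    refine Subgroup.mem_normalizer_iff.2 fun g => ⟨fun hg => h1 hg, fun hg => ?_⟩
    simpa [mul_assoc] using h2 hg

theorem tailSubgroup_eq_sup (a : Fin n → G) (i : Fin n) :
    tailSubgroup a i = Subgroup.zpowers (a i) ⊔ tailSubgroup a (i + 1) := by
  refine le_antisymm ((Subgroup.closure_le _).2 ?_)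
    (sup_le (Subgroup.zpowers_le.2 (mem_tailSubgroup a le_rfl)) (tailSubgroup_anti a (by omega)))
  rintro _ ⟨j, hj, rfl⟩
  rcases (show (i : ℕ) ≤ j from hj).lt_or_eq with hj' | hj'
  · exact Subgroup.mem_sup_right (mem_tailSubgroup a hj')
  · rw [Fin.ext hj']
    exact Subgroup.mem_sup_left (Subgroup.mem_zpowers _)

theorem exists_zpow_mul_eq {a : Fin n → G} {i : Fin n} (hN : (tailSubgroup a (i + 1)).Normal)
    {g : G} (hg : g ∈ tailSubgroup a i) :
    ∃ z : ℤ, ∃ b ∈ tailSubgroup a (i + 1), a i ^ z * b = g := by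
  rw [tailSubgroup_eq_sup, Subgroup.mem_sup_of_normal_right] at hg
  obtain ⟨_, ⟨z, rfl⟩, b, hb, h⟩ := hg
  exact ⟨z, b, hb, h⟩

theorem exists_orderedProd_eq {a : Fin n → G} (hN : ∀ k, (tailSubgroup a k).Normal) {g : G}
    (hg : g ∈ tailSubgroup a 0) : ∃ x, orderedProd a x = g := by
  induction n generalizing g with
  | zero =>
    rw [tailSubgroup_of_le a le_rfl, Subgroup.mem_bot] at hg
    exact ⟨0, by simp [orderedProd, hg]⟩
  | succ n ih =>
    obtain ⟨z, b, hb, rfl⟩ := exists_zpow_mul_eq (i := 0) (hN _) hg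
    have hb' : b ∈ tailSubgroup (fun i => a i.succ) 0 := by
      rw [tailSubgroup_succ]; exact hb
    obtain ⟨x, rfl⟩ := ih (fun k => by rw [tailSubgroup_succ]; exact hN _) hb'
    exact ⟨Fin.cons z x, by rw [orderedProd_succ]; simp⟩

/-- No nontrivial power of `a_i` lies in the subgroup generated by the later elements. -/
def Independent (a : Fin n → G) : Prop :=
  ∀ (i : Fin n) (z : ℤ), a i ^ z ∈ tailSubgroup a (i + 1) → z = 0

theorem Independent.succ {a : Fin (n + 1) → G} (h : Independent a) :
    Independent (fun i => a i.succ) := fun i z hz => by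
  rw [tailSubgroup_succ] at hz
  exact h i.succ z hz

theorem Independent.of_map {G' : Type*} [Group G'] (f : G →* G') {a : Fin n → G}
    (h : Independent fun i => f (a i)) : Independent a := fun i z hz => by
  refine h i z ?_
  rw [← tailSubgroup_map, ← map_zpow]
  exact Subgroup.mem_map_of_mem f hz

theorem Independent.eq_of_zpow_mul_eq {a : Fin (n + 1) → G} (h : Independent a) {x y : ℤ} {b c : G}
    (hb : b ∈ tailSubgroup a 1) (hc : c ∈ tailSubgroup a 1) (hxy : a 0 ^ x * b = a 0 ^ y * c) :
    x = y := by
  have h1 : a 0 ^ (x - y) = a 0 ^ (-y) * (a 0 ^ x * b) * b⁻¹ := by group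
  rw [hxy] at h1
  have h2 : a 0 ^ (x - y) = c * b⁻¹ := by rw [h1]; group
  refine sub_eq_zero.1 (h 0 _ ?_)
  rw [h2]
  exact mul_mem hc (inv_mem hb)

theorem Independent.orderedProd_injective {a : Fin n → G} (h : Independent a) :
    Function.Injective (orderedProd a) := by
  induction n with
  | zero => exact fun x y _ => Subsingleton.elim x y
  | succ n ih =>
    intro x y hxy
    rw [orderedProd_succ, orderedProd_succ] at hxy
    have h0 := h.eq_of_zpow_mul_eq (orderedProd_succ_mem a _) (orderedProd_succ_mem a _) hxy
    rw [h0] at hxy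
    have h1 := ih h.succ (mul_left_cancel hxy)
    funext i
    refine Fin.cases h0 (fun j => congrFun h1 j) i

/-- Read the equation modulo the tail, where only the first generator survives; independence says
that it has infinite order there. -/
theorem Independent.zpow_first_eq {a : Fin (n + 1) → G} (h : Independent a)
    (hN : (tailSubgroup a 1).Normal) {x y : Fin (n + 1) → ℤ} {u : ℤ}
    (hxy : orderedProd a x ^ u = orderedProd a y) : y 0 = x 0 * u := by
  have hmk : ∀ x : Fin (n + 1) → ℤ,
      ((orderedProd a x : G) : G ⧸ tailSubgroup a 1) = (a 0 : G ⧸ tailSubgroup a 1) ^ x 0 := by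
    intro x
    rw [orderedProd_succ, QuotientGroup.mk_mul, QuotientGroup.mk_zpow,
      (QuotientGroup.eq_one_iff _).2 (orderedProd_succ_mem a _), mul_one]
  have h1 := congrArg (QuotientGroup.mk : G → G ⧸ tailSubgroup a 1) hxy
  rw [QuotientGroup.mk_zpow, hmk, hmk, ← zpow_mul, ← QuotientGroup.mk_zpow,
    ← QuotientGroup.mk_zpow, QuotientGroup.eq, ← zpow_neg, ← zpow_add] at h1
  have := h 0 _ h1
  linarith

theorem exists_mk_eq_zpow {a : Fin n → G} (i : Fin n) [hN : (tailSubgroup a (i + 1)).Normal]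
    {g : G} (hg : g ∈ tailSubgroup a i) :
    ∃ z : ℤ, (g : G ⧸ tailSubgroup a (i + 1)) = (a i : G ⧸ tailSubgroup a (i + 1)) ^ z := by
  obtain ⟨z, b, hb, rfl⟩ := exists_zpow_mul_eq hN hg
  refine ⟨z, ?_⟩
  rw [← QuotientGroup.mk_zpow, eq_comm, QuotientGroup.eq]
  simpa using hb

/-- The powers `a ^ r` with `0 ≤ r < |z|` represent all cosets. -/
theorem relIndex_ne_zero_of_zpow_mem {A B : Subgroup G} [B.Normal] {a : G}
    (hcyc : ∀ g ∈ A, ∃ z : ℤ, (g : G ⧸ B) = (a : G ⧸ B) ^ z) {z : ℤ} (hz : z ≠ 0)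
    (hmem : a ^ z ∈ B) : B.relIndex A ≠ 0 := by
  have : NeZero z.natAbs := ⟨by simpa using hz⟩
  refine relIndex_ne_zero_of_cover (ι := ZMod z.natAbs) (fun r => a ^ (r.val : ℤ)) fun g hg => ?_
  obtain ⟨w, hw⟩ := hcyc g hg
  refine ⟨(w : ZMod z.natAbs), ?_⟩
  obtain ⟨q, hq⟩ : z ∣ w - ((w : ZMod z.natAbs).val : ℤ) := by
    rw [← Int.natAbs_dvd]
    refine (ZMod.intCast_eq_intCast_iff_dvd_sub _ _ _).1 ?_
    simp
  rw [← QuotientGroup.eq, hw, QuotientGroup.mk_zpow]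
  have h1 : w = ((w : ZMod z.natAbs).val : ℤ) + z * q := by linarith
  have h2 : (a : G ⧸ B) ^ z = 1 := by
    rw [← QuotientGroup.mk_zpow]
    exact (QuotientGroup.eq_one_iff _).2 hmem
  conv_rhs => rw [h1, zpow_add, zpow_mul, h2, one_zpow, mul_one]

theorem Satisfies.independent {t : Triple n → ℤ} {a : Fin n → G} (h : Satisfies t a)
    (hgen : Subgroup.closure (Set.range a) = ⊤) (hH : HasHirschLength G n) :
    Independent a := by
  intro i z hz
  by_contra hz0
  have hN := h.normal hgen
  refine relIndex_ne_zero_of_zpow_mem (fun g hg => exists_mk_eq_zpow i hg) hz0 hz ?_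
  -- The value `1` for `k ≥ n` only makes the family total; those indices are never inspected.
  refine relIndex_eq_zero_of_hasHirschLength (A := tailSubgroup a)
    (a := fun k => if hk : k < n then a ⟨k, hk⟩ else 1) hN
    (by rw [tailSubgroup_zero, hgen]) (tailSubgroup_of_le a le_rfl) ?_ hH i.2
  intro k hk g hg
  simp only [hk, dite_true]
  exact exists_mk_eq_zpow ⟨k, hk⟩ hg

theorem Satisfies.hasHirschLength {t : Triple n → ℤ} {a : Fin n → G} (h : Satisfies t a)
    (hgen : Subgroup.closure (Set.range a) = ⊤) (hind : Independent a) :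
    HasHirschLength G n := by
  have hN := h.normal hgen
  refine ⟨n, tailSubgroup a, by rw [tailSubgroup_zero, hgen], tailSubgroup_of_le a le_rfl,
    fun i hi => ⟨tailSubgroup_anti a (Nat.le_succ i), inferInstance, ?_⟩, ?_⟩
  · refine ⟨QuotientGroup.mk ⟨a ⟨i, hi⟩, mem_tailSubgroup a le_rfl⟩, ?_⟩
    rintro ⟨g, hg⟩
    obtain ⟨z, hz⟩ := exists_mk_eq_zpow ⟨i, hi⟩ hg
    rw [← QuotientGroup.mk_zpow, QuotientGroup.eq] at hz
    have h1 := inv_mem hz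
    exact ⟨z, QuotientGroup.eq.2 (Subgroup.mem_subgroupOf.2 (by simpa using h1))⟩
  · have hset : {i | i < n ∧ Infinite (tailSubgroup a i ⧸
        (tailSubgroup a (i + 1)).subgroupOf (tailSubgroup a i))} = Set.Iio n := by
      ext i
      refine ⟨fun hi => hi.1, fun hi => ⟨hi, infinite_quotient_iff_relIndex_eq_zero.2 ?_⟩⟩
      by_contra h0
      obtain ⟨k, hk, -, hmem⟩ := Subgroup.exists_pow_mem_of_relIndex_ne_zero h0
        (mem_tailSubgroup a (j := ⟨i, hi⟩) le_rfl)
      have h1 := hind ⟨i, hi⟩ k (by rw [zpow_natCast]; exact hmem.1)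
      omega
    rw [hset, Set.ncard_eq_toFinset_card']
    simp

end Series

/-! ### The groups `G(t)` and the embedding of `G(t_u)` -/

open MvPolynomial

theorem satisfies_gen {n : ℕ} (t : Triple n → ℤ) : Satisfies t (gen t) := fun i j hij => by
  have h := PresentedGroup.one_of_mem (rels := relators t) ⟨i, j, hij, rfl⟩
  rw [map_mul, map_inv, mul_inv_eq_one, map_mul, map_mul, map_mul, map_orderedProd] at h
  exact h

theorem closure_range_gen {n : ℕ} (t : Triple n → ℤ) :
    Subgroup.closure (Set.range (gen t)) = ⊤ :=
  PresentedGroup.closure_range_of _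

theorem exists_orderedProd_gen_eq {n : ℕ} (t : Triple n → ℤ) (g : NilpGroup t) :
    ∃ x, orderedProd (gen t) x = g :=
  exists_orderedProd_eq ((satisfies_gen t).normal (closure_range_gen t)) (by
    rw [tailSubgroup_zero, closure_range_gen]
    trivial)

theorem independent_gen {n : ℕ} {t : Triple n → ℤ} (ht : t ∈ consistentSet n) :
    Independent (gen t) :=
  (satisfies_gen t).independent (closure_range_gen t) ht

/-- The homomorphism from `G(t)` determined by elements satisfying its relations. -/
def Satisfies.lift {G : Type*} [Group G] {n : ℕ} {t : Triple n → ℤ} {a : Fin n → G}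
    (h : Satisfies t a) : NilpGroup t →* G :=
  PresentedGroup.toGroup (f := a) (by
    rintro _ ⟨i, j, hij, rfl⟩
    rw [map_mul, map_inv, mul_inv_eq_one, map_mul, map_mul, map_mul, map_orderedProd]
    simpa using h i j hij)

@[simp]
theorem Satisfies.lift_gen {G : Type*} [Group G] {n : ℕ} {t : Triple n → ℤ} {a : Fin n → G}
    (h : Satisfies t a) (i : Fin n) : h.lift (gen t i) = a i :=
  PresentedGroup.toGroup.of _

theorem Satisfies.lift_orderedProd {G : Type*} [Group G] {n : ℕ} {t : Triple n → ℤ}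
    {a : Fin n → G} (h : Satisfies t a) (x : Fin n → ℤ) :
    h.lift (orderedProd (gen t) x) = orderedProd a x := by
  simp [map_orderedProd]

theorem Satisfies.lift_injective {G : Type*} [Group G] {n : ℕ} {t : Triple n → ℤ} {a : Fin n → G}
    (h : Satisfies t a) (hind : Independent a) : Function.Injective h.lift := by
  intro g g' hgg
  obtain ⟨x, rfl⟩ := exists_orderedProd_gen_eq t g
  obtain ⟨y, rfl⟩ := exists_orderedProd_gen_eq t g'
  rw [h.lift_orderedProd, h.lift_orderedProd] at hgg
  rw [hind.orderedProd_injective hgg]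

theorem Satisfies.range_lift {G : Type*} [Group G] {n : ℕ} {t : Triple n → ℤ} {a : Fin n → G}
    (h : Satisfies t a) : h.lift.range = Subgroup.closure (Set.range a) := by
  rw [MonoidHom.range_eq_map, ← closure_range_gen, MonoidHom.map_closure, ← Set.range_comp]
  congr 2
  funext i
  simp

/-- The homomorphism `G(t_u) → G(t)` sending the `i`-th generator to `a_{i+1}`. -/
def dropFirstHom {n : ℕ} (t : Triple (n + 1) → ℤ) : NilpGroup (dropFirst t) →* NilpGroup t :=
  (satisfies_gen t).succ.lift

theorem dropFirst_mem_consistentSet {n : ℕ} {t : Triple (n + 1) → ℤ}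
    (ht : t ∈ consistentSet (n + 1)) : dropFirst t ∈ consistentSet n := by
  refine (satisfies_gen _).hasHirschLength (closure_range_gen _)
    (Independent.of_map (dropFirstHom t) ?_)
  simpa only [dropFirstHom, Satisfies.lift_gen] using (independent_gen ht).succ

theorem exists_mulEquiv_subgroupU {n : ℕ} {t : Triple (n + 1) → ℤ}
    (ht : t ∈ consistentSet (n + 1)) :
    ∃ f : NilpGroup (dropFirst t) ≃* subgroupU t,
      ∀ i, (f (gen (dropFirst t) i) : NilpGroup t) = gen t i.succ := by
  have hs := (satisfies_gen t).succ
  refine ⟨(MonoidHom.ofInjective (hs.lift_injective (independent_gen ht).succ)).trans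
    (MulEquiv.subgroupCongr hs.range_lift), fun i => ?_⟩
  exact hs.lift_gen i

/-- Powers of `a_2 a_3^{c_3} ⋯ a_n^{c_n}` are computed by the powering polynomials. -/
theorem zpow_mul_zpow_of_powering {m : ℕ} {t : Triple (m + 3) → ℤ}
    (ht : t ∈ consistentSet (m + 3)) {c : Fin (m + 1) → ℤ} {v : ℤ}
    (hc : gen t 1 * gen t 0 ^ v = gen t 0 ^ v * gen t 1 * orderedProd (gen t) (fromThird c))
    {u : ℤ} {e : Fin (m + 2) → ℤ}
    (he : orderedProd (gen (dropFirst t)) (Fin.cons 1 c) ^ u =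
      orderedProd (gen (dropFirst t)) e) :
    gen t 1 ^ u * gen t 0 ^ v =
      gen t 0 ^ v * gen t 1 ^ u * orderedProd (gen t) (fromThird fun k => e k.succ) := by
  -- The first exponent of the power is `u`, so its first factor is exactly `a_2 ^ u`.
  have h0 := (independent_gen (dropFirst_mem_consistentSet ht)).zpow_first_eq
    ((satisfies_gen _).normal (closure_range_gen _) 1) he
  rw [Fin.cons_zero, one_mul] at h0
  have he' := congrArg (dropFirstHom t) he
  rw [map_zpow, dropFirstHom, Satisfies.lift_orderedProd, Satisfies.lift_orderedProd,
    orderedProd_succ, orderedProd_succ _ e, h0] at he'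
  rw [orderedProd_succ, orderedProd_succ, ← Fin.succ_zero_eq_one] at hc ⊢
  simp only [fromThird, Fin.cons_zero, Fin.cons_succ, zpow_zero, zpow_one, one_mul] at hc he' ⊢
  -- Conjugation commutes with powers, so conjugating `a_2 ^ u` amounts to powering the conjugate of
  -- `a_2`.
  have h1 : gen t (Fin.succ 0) ^ u * gen t 0 ^ v =
      gen t 0 ^ v * ((gen t 0 ^ v)⁻¹ * gen t (Fin.succ 0) * (gen t 0 ^ v)⁻¹⁻¹) ^ u := by
    rw [conj_zpow]
    group
  rw [h1, inv_inv, mul_assoc (gen t 0 ^ v)⁻¹, hc, mul_assoc (gen t 0 ^ v) (gen t (Fin.succ 0)),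
    inv_mul_cancel_left, he', mul_assoc]

/-! ### Specialization and substitution of polynomials -/

section Values

variable {n : ℕ} {σ : Type}

theorem eval_specialize (t : Triple n → ℤ) (s : σ → ℤ) (P : ParamPoly n σ) :
    eval (fun w => (s w : ℚ)) (specialize t P) = value t s P := by
  have h : (aeval (fun w => (s w : ℚ))).comp (specialize t) =
      (aeval (fun w => ((Sum.elim t s w : ℤ) : ℚ)) : ParamPoly n σ →ₐ[ℚ] ℚ) := by
    refine algHom_ext fun w => ?_
    rcases w with p | w <;> simp [specialize]
  have h1 := DFunLike.congr_fun h P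
  simpa [value, coe_aeval_eq_eval] using h1

/-- A rational polynomial is determined by its values on the integer grid, since `ℤ` is infinite in
`ℚ`. -/
theorem specialize_eq_of_value_eq {t : Triple n → ℤ} {P Q : ParamPoly n σ}
    (h : ∀ s, value t s P = value t s Q) : specialize t P = specialize t Q := by
  refine funext_set (fun _ => Set.range ((↑) : ℤ → ℚ))
    (fun _ => Set.infinite_range_of_injective Int.cast_injective) fun x hx => ?_
  choose s hs using fun i => hx i trivial
  obtain rfl : (fun i => (s i : ℚ)) = x := funext hs
  rw [eval_specialize, eval_specialize, h]

theorem value_aeval {n' : ℕ} {σ' : Type} {t : Triple n → ℤ} {s : σ → ℤ} {t' : Triple n' → ℤ}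
    {s' : σ' → ℤ} {g : Triple n' ⊕ σ' → ParamPoly n σ}
    (h : ∀ w, value t s (g w) = (Sum.elim t' s' w : ℤ)) (P : ParamPoly n' σ') :
    value t s (aeval g P) = value t' s' P := by
  have h' : (aeval (fun w => ((Sum.elim t s w : ℤ) : ℚ))).comp (aeval g) =
      (aeval (fun w => ((Sum.elim t' s' w : ℤ) : ℚ)) : ParamPoly n' σ' →ₐ[ℚ] ℚ) := by
    refine algHom_ext fun w => ?_
    rw [AlgHom.comp_apply, aeval_X, aeval_X, ← h, value]
    simp
  have h1 := DFunLike.congr_fun h' P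
  simpa [value, coe_aeval_eq_eval] using h1

theorem value_atOne (t : Triple n → ℤ) (v : ℤ) (P : ParamPoly n ConjVar) :
    value t (fun _ => v) (atOne P) = value t (conjVals 1 v) P := by
  refine value_aeval (fun w => ?_) P
  rcases w with p | _ | _ <;> simp [value, conjVals]

theorem value_rename_v (t : Triple n → ℤ) (u v : ℤ) (P : ParamPoly n UnitVar) :
    value t (conjVals u v) (rename (Sum.map id fun _ => ConjVar.v) P) =
      value t (fun _ => v) P := by
  rw [value, eval_rename, value]
  congr 2
  funext w
  rcases w with p | _ <;> rfl

theorem value_powerSubst {m : ℕ} {t : Triple (m + 3) → ℤ} {u v : ℤ}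
    {ρ : Fin (m + 1) → ParamPoly (m + 3) UnitVar} {c : Fin (m + 1) → ℤ}
    (hc : ∀ k, value t (fun _ => v) (ρ k) = c k) (K : ParamPoly (m + 2) (PowVar (m + 2))) :
    value t (conjVals u v) (powerSubst K ρ) =
      value (dropFirst t) (powVals (Fin.cons 1 c) u) K := by
  refine value_aeval (fun w => ?_) K
  rcases w with p | i | _
  · simp [value, dropFirst]
  · simp only [Sum.elim_inr, value_rename_v, powVals]
    refine Fin.cases ?_ (fun k => ?_) i
    · simp [value]
    · simpa using hc k
  · simp [value, powVals, conjVals]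

end Values

/-! ### Conjugation polynomials for the pair `(1, 2)` -/

theorem IsConjugation.isConjugationOneTwo {m : ℕ} {R : Triple (m + 3) → ParamPoly (m + 3) ConjVar}
    (hR : IsConjugation R) : IsConjugationOneTwo fun k => R (tripleOneTwo k) := by
  intro t ht u v
  obtain ⟨e, he, h⟩ := hR t ht u v
  refine ⟨fun k => e (tripleOneTwo k), fun k => he _, ?_⟩
  rw [h 0 1 (Fin.succ_pos 0)]
  congr 2
  funext i
  refine Fin.cases ?_ (Fin.cases ?_ fun k => ?_) i
  · simp [tailExp, fromThird]
  · simp [tailExp, fromThird]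
  · have : (1 : Fin (m + 3)) < k.succ.succ := Fin.succ_lt_succ_iff.2 (Fin.succ_pos k)
    simp [tailExp, fromThird, this, tripleOneTwo]

theorem IsConjugationOneTwo.atOne {m : ℕ} {P : Fin (m + 1) → ParamPoly (m + 3) ConjVar}
    (hP : IsConjugationOneTwo P) : IsUnitConjugationOneTwo fun k => atOne (P k) := by
  intro t ht v
  obtain ⟨e, he, h⟩ := hP t ht 1 v
  exact ⟨e, fun k => by rw [value_atOne, he], by simpa using h⟩

theorem IsPowering.isConjugationOneTwo {m : ℕ}
    {K : Fin (m + 2) → ParamPoly (m + 2) (PowVar (m + 2))} (hK : IsPowering K)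
    {ρ : Fin (m + 1) → ParamPoly (m + 3) UnitVar} (hρ : IsUnitConjugationOneTwo ρ) :
    IsConjugationOneTwo fun k => powerSubst (K k.succ) ρ := by
  intro t ht u v
  obtain ⟨c, hc, hrel⟩ := hρ t ht v
  obtain ⟨e, he, hpow⟩ := hK _ (dropFirst_mem_consistentSet ht) (Fin.cons 1 c) u
  exact ⟨fun k => e k.succ, fun k => by rw [value_powerSubst hc, he],
    zpow_mul_zpow_of_powering ht hrel hpow⟩

/-- Both families give exponents of the same normal form, so their values agree at all integers `u,
v`. -/
theorem IsConjugationOneTwo.specialize_eq {m : ℕ} {P Q : Fin (m + 1) → ParamPoly (m + 3) ConjVar}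
    (hP : IsConjugationOneTwo P) (hQ : IsConjugationOneTwo Q) {t : Triple (m + 3) → ℤ}
    (ht : t ∈ consistentSet (m + 3)) (k : Fin (m + 1)) :
    specialize t (P k) = specialize t (Q k) := by
  refine specialize_eq_of_value_eq fun s => ?_
  have hs : conjVals (s .u) (s .v) = s := funext fun w => by cases w <;> rfl
  obtain ⟨e, he, h⟩ := hP t ht (s .u) (s .v)
  obtain ⟨e', he', h'⟩ := hQ t ht (s .u) (s .v)
  have h1 := congrFun ((independent_gen ht).orderedProd_injective
    (mul_left_cancel (h.symm.trans h'))) k.succ.succ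
  simp only [fromThird, Fin.cons_succ] at h1
  rw [← hs, he, he', h1]

end HallPoly

theorem mainTheorem8 (m : ℕ) :
    -- R_{1,2,n}(t; u, v) = K_{n-1}(t_u; r, u), where n = m + 3
    (∀ (K : Fin (m + 2) → HallPoly.ParamPoly (m + 2) (HallPoly.PowVar (m + 2)))
      (R : HallPoly.Triple (m + 3) → HallPoly.ParamPoly (m + 3) HallPoly.ConjVar),
      HallPoly.IsPowering K → HallPoly.IsConjugation R →
      ∀ t ∈ HallPoly.consistentSet (m + 3),
        HallPoly.specialize t (R (HallPoly.tripleOneTwo (Fin.last m))) =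
          HallPoly.specialize t (HallPoly.powerSubst (K (Fin.last (m + 1)))
            (fun k => HallPoly.atOne (R (HallPoly.tripleOneTwo k))))) ∧
    -- the case u = 1 yields the case of general u
    (∀ (K : Fin (m + 2) → HallPoly.ParamPoly (m + 2) (HallPoly.PowVar (m + 2)))
      (ρ : Fin (m + 1) → HallPoly.ParamPoly (m + 3) HallPoly.UnitVar),
      HallPoly.IsPowering K → HallPoly.IsUnitConjugationOneTwo ρ →
      HallPoly.IsConjugationOneTwo (fun k => HallPoly.powerSubst (K k.succ) ρ)) ∧
    -- powering in U(t) is powering in G(t_u)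
    (∀ t ∈ HallPoly.consistentSet (m + 3),
      HallPoly.dropFirst t ∈ HallPoly.consistentSet (m + 2) ∧
      ∃ f : HallPoly.NilpGroup (HallPoly.dropFirst t) ≃* HallPoly.subgroupU t,
        ∀ i, (f (HallPoly.gen (HallPoly.dropFirst t) i) : HallPoly.NilpGroup t) =
          HallPoly.gen t i.succ) :=
  ⟨fun _ _ hK hR _ ht => hR.isConjugationOneTwo.specialize_eq
      (hK.isConjugationOneTwo hR.isConjugationOneTwo.atOne) ht (Fin.last m),
    fun _ _ hK hρ => hK.isConjugationOneTwo hρ,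
    fun _ ht => ⟨HallPoly.dropFirst_mem_consistentSet ht, HallPoly.exists_mulEquiv_subgroupU ht⟩⟩
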